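/- A SAT oracle for formulas over $n$ propositional variables is a map $O$ that sends each satisfiable Boolean formula $\chi$ over these variables to some satisfying assignment of $\chi$, and each unsatisfiable one to $\bot$; nothing else about its answers is guaranteed. Consider randomized adaptive algorithms whose only access to the input formula $\varphi$ over $n$ variables is through oracle queries of the form $\varphi\wedge\psi_A$, where $A\subseteq\{T,F\}^n$ is an arbitrary set that may depend on the previous answers and on the internal randomness, and $\psi_A$ is a formula over the same $n$ variables whose set of satisfying assignments is $A$. Write $\mathrm{sol}(\varphi)$ for the set of satisfying assignments of $\varphi$. Such an algorithm computes an $(\varepsilon,\delta)$-approximation of the model count if, for every formula $\varphi$ over $n$ variables and every SAT oracle, its output $\mathrm{Est}$ satisfies $$\Pr\left[\frac{|\mathrm{sol}(\varphi)|}{1+\varepsilon}\le \mathrm{Est}\le (1+\varepsilon)\,|\mathrm{sol}(\varphi)|\right]\ge 1-\delta ,$$ the probability being over the internal randomness of the algorithm. **Theorem.** For all $\varepsilon,\delta\in(0,1)$ there are $c>0$ and $N$ such that for every $n\ge N$, every such algorithm that computes an $(\varepsilon,\delta)$-approximation of the model count for formulas over $n$ variables and that always makes at most $q$ oracle queries satisfies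 $$q\ \ge\ c\,\frac{\log n}{\log\log n}.$$ -/

import Mathlib

open MeasureTheory

/-- Truth assignments to the propositional variables `v_0, …, v_{n-1}`. -/
abbrev Assignment (n : ℕ) : Type := Fin n → Bool

/-- Boolean formulas over `n` propositional variables. -/
inductive BoolFormula (n : ℕ) : Type
  | const (b : Bool) : BoolFormula n
  | var (i : Fin n) : BoolFormula n
  | neg (φ : BoolFormula n) : BoolFormula n
  | and (φ ψ : BoolFormula n) : BoolFormula n
  | or (φ ψ : BoolFormula n) : BoolFormula n

namespace BoolFormula

/-- The truth value of a formula under an assignment. -/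
def eval {n : ℕ} : BoolFormula n → Assignment n → Bool
  | const b, _ => b
  | var i, s => s i
  | neg φ, s => !(φ.eval s)
  | and φ ψ, s => φ.eval s && ψ.eval s
  | or φ ψ, s => φ.eval s || ψ.eval s

/-- `sol φ`: the set of satisfying assignments of `φ`. -/
def sol {n : ℕ} (φ : BoolFormula n) : Finset (Assignment n) :=
  Finset.univ.filter fun s => φ.eval s = true

/-- Every set `A` of assignments is the solution set of some formula `ψ_A`, so that asking about
`φ ∧ ψ` for arbitrary formulas `ψ` is asking about `sol φ ∩ A` for arbitrary sets `A`. -/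
theorem exists_sol_eq {n : ℕ} (A : Finset (Assignment n)) : ∃ ψ : BoolFormula n, ψ.sol = A := by
  classical
  have key : ∀ (a : Assignment n) (I : Finset (Fin n)),
      ∃ ψ : BoolFormula n, ∀ s, ψ.eval s = true ↔ ∀ i ∈ I, s i = a i := by
    intro a I
    induction I using Finset.induction_on with
    | empty => exact ⟨const true, by simp [eval]⟩
    | insert i I _ ih =>
      obtain ⟨ψ, hψ⟩ := ih
      cases h : a i with
      | true => exact ⟨and (var i) ψ, by simp [eval, hψ, h]⟩
      | false => exact ⟨and (neg (var i)) ψ, by simp [eval, hψ, h]⟩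
  induction A using Finset.induction_on with
  | empty => exact ⟨const false, by simp [sol, eval]⟩
  | insert a A _ ih =>
    obtain ⟨ψ, hψ⟩ := ih
    obtain ⟨χ, hχ⟩ := key a Finset.univ
    refine ⟨or χ ψ, ?_⟩
    ext s
    rw [← hψ]
    simp [sol, eval, hχ, funext_iff]

end BoolFormula

/-- `O` is a SAT oracle: on a satisfiable formula it returns some satisfying assignment of it, and
on an unsatisfiable formula it returns `⊥` (here `none`). Nothing else is known about its answers. -/
def IsSATOracle {n : ℕ} (O : BoolFormula n → Option (Assignment n)) : Prop :=
  ∀ φ : BoolFormula n,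
    (φ.sol.Nonempty → ∃ s ∈ φ.sol, O φ = some s) ∧ (φ.sol = ∅ → O φ = none)

/-- A deterministic adaptive algorithm on inputs with `n` variables, as a decision tree: it either
stops with a real estimate, or chooses a formula `ψ`, has the oracle asked about `φ ∧ ψ`, where `φ`
is the input formula, and continues depending on the answer. It has no other access to `φ`. -/
inductive QueryTree (n : ℕ) : Type
  | output (est : ℝ) : QueryTree n
  | query (ψ : BoolFormula n) (next : Option (Assignment n) → QueryTree n) : QueryTree n

namespace QueryTree

/-- The estimate that is returned on input `φ` when the oracle is `O`. -/
def estimate {n : ℕ} (O : BoolFormula n → Option (Assignment n)) (φ : BoolFormula n) :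
    QueryTree n → ℝ
  | output est => est
  | query ψ next => (next (O (φ.and ψ))).estimate O φ

/-- The number of oracle queries made on input `φ` when the oracle is `O`. -/
def numQueries {n : ℕ} (O : BoolFormula n → Option (Assignment n)) (φ : BoolFormula n) :
    QueryTree n → ℕ
  | output _ => 0
  | query ψ next => (next (O (φ.and ψ))).numQueries O φ + 1

end QueryTree

/-- A randomized adaptive algorithm: a deterministic one for each value of the internal randomness
`ω : Ω`, such that the estimate is a random variable. -/
structure RandomizedCounter (n : ℕ) (Ω : Type*) [MeasurableSpace Ω] where
  tree : Ω → QueryTree n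
  measurable_estimate : ∀ (O : BoolFormula n → Option (Assignment n)), IsSATOracle O →
    ∀ φ : BoolFormula n, Measurable fun ω => (tree ω).estimate O φ

namespace RandomizedCounter

/-- The algorithm never makes more than `q` oracle queries. -/
def MakesAtMost {n : ℕ} {Ω : Type*} [MeasurableSpace Ω] (alg : RandomizedCounter n Ω)
    (q : ℕ) : Prop :=
  ∀ (O : BoolFormula n → Option (Assignment n)), IsSATOracle O →
    ∀ (φ : BoolFormula n) (ω : Ω), (alg.tree ω).numQueries O φ ≤ q

/-- The algorithm computes an `(ε, δ)`-approximation of `|sol φ|` for every input formula `φ`,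
whichever SAT oracle it is given; the probability is over its internal randomness. -/
def Approximates {n : ℕ} {Ω : Type*} [MeasurableSpace Ω] (alg : RandomizedCounter n Ω)
    (μ : Measure Ω) (ε δ : ℝ) : Prop :=
  ∀ (O : BoolFormula n → Option (Assignment n)), IsSATOracle O → ∀ φ : BoolFormula n,
    1 - δ ≤ μ.real {ω | (φ.sol.card : ℝ) / (1 + ε) ≤ (alg.tree ω).estimate O φ ∧
      (alg.tree ω).estimate O φ ≤ (1 + ε) * (φ.sol.card : ℝ)}

end RandomizedCounter

/-!
Fix an enumeration of all assignments and let the oracle return the first satisfying assignment.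
If `sol φ` is an initial segment of the enumeration, the answer to `φ ∧ ψ` is either `⊥` or the
first satisfying assignment of `ψ`, which does not depend on `φ`. A deterministic algorithm with
`q` queries therefore produces at most `2 ^ q` different estimates on all these inputs.
If `(1 + ε)² < 2 ^ k`, no estimate is acceptable for two of the model counts
`1, 2 ^ k, 4 ^ k, …`, of which about `n / k` are at most `2 ^ n`. So each run is correct for at
most `2 ^ q` of them, and averaging over the randomness gives `(1 - δ) n / k ≤ 2 ^ q`.
-/

/-- The real numbers that are acceptable as a `(1 + ε)`-approximation of `x`. -/
def approxInterval (ε x : ℝ) : Set ℝ :=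
  Set.Icc (x / (1 + ε)) ((1 + ε) * x)

theorem pairwise_disjoint_approxInterval_pow {ε b : ℝ} (hε : 0 ≤ ε) (hb : (1 + ε) ^ 2 < b) :
    Pairwise (Function.onFun Disjoint fun i : ℕ => approxInterval ε (b ^ i)) := by
  rw [pairwise_disjoint_on]
  intro i j hij
  have hb_one : 1 < b := (one_le_pow₀ (by linarith)).trans_lt hb
  have hgap : (1 + ε) * b ^ i < b ^ j / (1 + ε) := by
    rw [lt_div_iff₀ (by linarith)]
    calc (1 + ε) * b ^ i * (1 + ε) = (1 + ε) ^ 2 * b ^ i := by ring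
      _ < b * b ^ i := by gcongr
      _ = b ^ (i + 1) := (pow_succ' b i).symm
      _ ≤ b ^ j := pow_le_pow_right₀ hb_one.le hij
  exact Set.disjoint_left.2 fun x hxi hxj => (hxi.2.trans_lt hgap).not_ge hxj.1

theorem card_le_of_pairwiseDisjoint_of_mem {ι α : Type*} {I : Finset ι} {S : Finset α}
    {W : ι → Set α} {f : ι → α} (hW : (I : Set ι).PairwiseDisjoint W)
    (hfW : ∀ i ∈ I, f i ∈ W i) (hfS : ∀ i ∈ I, f i ∈ S) : I.card ≤ S.card :=
  Finset.card_le_card_of_injOn f hfS fun i hi j hj hij =>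
    hW.elim_set hi hj (f i) (hfW i hi) (hij ▸ hfW j hj)

open Classical in
theorem sum_measureReal_le_of_card_filter_le {Ω ι : Type*} [MeasurableSpace Ω] {μ : Measure Ω}
    [IsFiniteMeasure μ] {I : Finset ι} {E : ι → Set Ω} {K : ℕ}
    (hE : ∀ i ∈ I, MeasurableSet (E i)) (hK : ∀ ω, (I.filter fun i => ω ∈ E i).card ≤ K) :
    ∑ i ∈ I, μ.real (E i) ≤ K * μ.real Set.univ := by
  have hint : ∀ i ∈ I, Integrable ((E i).indicator (1 : Ω → ℝ)) μ := fun i hi =>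
    (integrable_const (1 : ℝ)).indicator (hE i hi)
  calc ∑ i ∈ I, μ.real (E i) = ∫ ω, ∑ i ∈ I, (E i).indicator (1 : Ω → ℝ) ω ∂μ := by
        rw [integral_finsetSum _ hint]
        exact Finset.sum_congr rfl fun i hi => (integral_indicator_one (hE i hi)).symm
    _ ≤ ∫ _, (K : ℝ) ∂μ := by
        refine integral_mono (integrable_finsetSum _ hint) (integrable_const _) fun ω => ?_
        simp only [Set.indicator_apply, Pi.one_apply, Finset.sum_boole]
        exact_mod_cast hK ω
    _ = K * μ.real Set.univ := by rw [integral_const, smul_eq_mul, mul_comm]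

theorem filter_mem_left_of_nodup_append {α : Type*} [DecidableEq α] {l₁ l₂ : List α}
    (h : (l₁ ++ l₂).Nodup) : (l₁ ++ l₂).filter (· ∈ l₁) = l₁ := by
  have hleft : l₁.filter (· ∈ l₁) = l₁ := List.filter_eq_self.2 fun a ha => by simpa using ha
  have hright : l₂.filter (· ∈ l₁) = [] := List.filter_eq_nil_iff.2 fun a ha => by
    simpa using fun ha' => List.disjoint_of_nodup_append h ha' ha
  rw [List.filter_append, hleft, hright, List.append_nil]

namespace BoolFormula

variable {n : ℕ}

theorem mem_sol {φ : BoolFormula n} {s : Assignment n} : s ∈ φ.sol ↔ φ.eval s = true := by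
  simp [sol]

/-- The SAT oracle that returns the first satisfying assignment in a fixed enumeration of all
assignments, namely the arbitrary one chosen by `Finset.toList`. -/
noncomputable def firstSolution (χ : BoolFormula n) : Option (Assignment n) :=
  (Finset.univ : Finset (Assignment n)).toList.find? χ.eval

theorem isSATOracle_firstSolution : IsSATOracle (firstSolution (n := n)) := by
  refine fun χ => ⟨fun ⟨t, ht⟩ => ?_, fun hempty => ?_⟩
  · have hsome : χ.firstSolution.isSome := List.find?_isSome.2 ⟨t, by simp, mem_sol.1 ht⟩
    obtain ⟨s, hs⟩ := Option.isSome_iff_exists.1 hsome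
    exact ⟨s, mem_sol.2 (List.find?_some hs), hs⟩
  · refine List.find?_eq_none.2 fun s _ hs => ?_
    simpa [hempty] using mem_sol.2 hs

/-- The solutions of `φ` form an initial segment of the enumeration of all assignments that is
used by `firstSolution`. -/
def IsInitial (φ : BoolFormula n) : Prop :=
  (Finset.univ : Finset (Assignment n)).toList.filter φ.eval <+:
    (Finset.univ : Finset (Assignment n)).toList

theorem IsInitial.firstSolution_and {φ : BoolFormula n} (hφ : φ.IsInitial) (ψ : BoolFormula n) :
    (φ.and ψ).firstSolution = none ∨ (φ.and ψ).firstSolution = ψ.firstSolution := by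
  have hfilter : (φ.and ψ).firstSolution =
      ((Finset.univ : Finset (Assignment n)).toList.filter φ.eval).find? ψ.eval := by
    rw [List.find?_filter]
    simp [firstSolution, eval]
  rw [hfilter]
  cases hs : ((Finset.univ : Finset (Assignment n)).toList.filter φ.eval).find? ψ.eval with
  | none => exact Or.inl rfl
  | some s => exact Or.inr (hφ.find?_eq_some hs).symm

theorem exists_isInitial_card_sol_eq {m : ℕ} (hm : m ≤ 2 ^ n) :
    ∃ φ : BoolFormula n, φ.IsInitial ∧ φ.sol.card = m := by
  set L := (Finset.univ : Finset (Assignment n)).toList with hL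
  have hnodup : L.Nodup := Finset.nodup_toList _
  have hlength : L.length = 2 ^ n := by simp [hL]
  obtain ⟨φ, hφ⟩ := exists_sol_eq (L.take m).toFinset
  have heval : φ.eval = fun s => decide (s ∈ L.take m) := by
    ext s
    rw [Bool.eq_iff_iff, ← mem_sol, hφ, List.mem_toFinset, decide_eq_true_iff]
  have hfilter : L.filter φ.eval = L.take m := by
    have := filter_mem_left_of_nodup_append ((L.take_append_drop m).symm ▸ hnodup)
    rwa [List.take_append_drop, ← heval] at this
  refine ⟨φ, ?_, ?_⟩
  · rw [IsInitial, ← hL, hfilter]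
    exact List.take_prefix m L
  · rw [hφ, List.toFinset_card_of_nodup (hnodup.sublist (List.take_sublist m L)),
      List.length_take_of_le (hlength ▸ hm)]

end BoolFormula

theorem QueryTree.exists_finset_estimate_mem {n k : ℕ} {O : BoolFormula n → Option (Assignment n)}
    {F : Set (BoolFormula n)} {A : BoolFormula n → Finset (Option (Assignment n))} (hk : 1 ≤ k)
    (hA : ∀ ψ, (A ψ).card ≤ k) (hO : ∀ φ ∈ F, ∀ ψ, O (φ.and ψ) ∈ A ψ) (T : QueryTree n) (q : ℕ) :
    ∃ S : Finset ℝ, S.card ≤ k ^ q ∧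
      ∀ φ ∈ F, T.numQueries O φ ≤ q → T.estimate O φ ∈ S := by
  induction T generalizing q with
  | output est => exact ⟨{est}, by simpa using Nat.one_le_pow q k hk, by simp [estimate]⟩
  | query ψ next ih =>
    cases q with
    | zero => exact ⟨∅, by simp, by simp [numQueries]⟩
    | succ q =>
      choose S hcard hmem using fun a => ih a q
      refine ⟨(A ψ).biUnion S, ?_, fun φ hφ hq => ?_⟩
      · calc ((A ψ).biUnion S).card ≤ (A ψ).card * k ^ q :=
              Finset.card_biUnion_le_card_mul _ _ _ fun a _ => hcard a
          _ ≤ k ^ (q + 1) := by rw [pow_succ']; gcongr; exact hA ψ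
      · exact Finset.mem_biUnion.2
          ⟨_, hO φ hφ ψ, hmem _ φ hφ (Nat.le_of_succ_le_succ hq)⟩

namespace RandomizedCounter

variable {n q : ℕ} {Ω : Type*} [MeasurableSpace Ω] {μ : Measure Ω} [IsProbabilityMeasure μ]
  {alg : RandomizedCounter n Ω} {ε δ : ℝ}

theorem Approximates.card_mul_le_two_pow {ι : Type*} {I : Finset ι} {m : ι → ℕ}
    (happ : alg.Approximates μ ε δ) (hq : alg.MakesAtMost q) (hm : ∀ i ∈ I, m i ≤ 2 ^ n)
    (hdisj : (I : Set ι).PairwiseDisjoint fun i => approxInterval ε (m i)) :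
    I.card * (1 - δ) ≤ 2 ^ q := by
  classical
  have : Nonempty (BoolFormula n) := ⟨.const true⟩
  have horacle := BoolFormula.isSATOracle_firstSolution (n := n)
  choose! Φ hinit hcard using fun i hi => BoolFormula.exists_isInitial_card_sol_eq (hm i hi)
  let est (i : ι) (ω : Ω) : ℝ := (alg.tree ω).estimate BoolFormula.firstSolution (Φ i)
  have hprob : ∀ i ∈ I, 1 - δ ≤ μ.real (est i ⁻¹' approxInterval ε (m i)) := fun i hi => by
    rw [← hcard i hi]
    exact happ _ horacle (Φ i)
  have hmeas : ∀ i ∈ I, MeasurableSet (est i ⁻¹' approxInterval ε (m i)) := fun i _ =>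
    alg.measurable_estimate _ horacle (Φ i) measurableSet_Icc
  have hfew : ∀ ω, (I.filter fun i => ω ∈ est i ⁻¹' approxInterval ε (m i)).card ≤ 2 ^ q := by
    intro ω
    obtain ⟨S, hScard, hS⟩ := QueryTree.exists_finset_estimate_mem (F := {φ | φ.IsInitial})
      (A := fun ψ => {none, ψ.firstSolution}) one_le_two (fun _ => Finset.card_le_two)
      (fun φ hφ ψ => by simpa using hφ.firstSolution_and ψ) (alg.tree ω) q
    exact (card_le_of_pairwiseDisjoint_of_mem (f := fun i => est i ω)
      (hdisj.subset (Finset.filter_subset _ _)) (fun i hi => (Finset.mem_filter.1 hi).2)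
      fun i hi => hS _ (hinit i (Finset.mem_filter.1 hi).1) (hq _ horacle _ ω)).trans hScard
  calc (I.card : ℝ) * (1 - δ) = ∑ _i ∈ I, (1 - δ) := by rw [Finset.sum_const, nsmul_eq_mul]
    _ ≤ ∑ i ∈ I, μ.real (est i ⁻¹' approxInterval ε (m i)) := Finset.sum_le_sum hprob
    _ ≤ 2 ^ q := by simpa using sum_measureReal_le_of_card_filter_le (μ := μ) hmeas hfew

theorem Approximates.div_mul_le_two_pow {k : ℕ} (happ : alg.Approximates μ ε δ)
    (hq : alg.MakesAtMost q) (hε : 0 ≤ ε) (hδ : δ ≤ 1) (hk : (1 + ε) ^ 2 < 2 ^ k) :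
    (1 - δ) / k * n ≤ 2 ^ q := by
  have hk_pos : 0 < k := Nat.pos_of_ne_zero (by rintro rfl; nlinarith)
  have hsize : ∀ i ∈ Finset.range (n / k + 1), (2 ^ k) ^ i ≤ 2 ^ n := fun i hi => by
    rw [← pow_mul]
    exact Nat.pow_le_pow_right two_pos <| (Nat.mul_le_mul_left k
      (Finset.mem_range_succ_iff.1 hi)).trans (Nat.mul_div_le n k)
  have hcount := happ.card_mul_le_two_pow hq hsize fun i _ j _ hij => by
    simpa using pairwise_disjoint_approxInterval_pow hε hk hij
  have hdiv : (n : ℝ) / k ≤ (Finset.range (n / k + 1)).card := by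
    rw [Finset.card_range, div_le_iff₀ (by exact_mod_cast hk_pos)]
    exact_mod_cast (Nat.lt_mul_of_div_lt (Nat.lt_succ_self _) hk_pos).le
  calc (1 - δ) / k * n = n / k * (1 - δ) := by ring
    _ ≤ (Finset.range (n / k + 1)).card * (1 - δ) :=
        mul_le_mul_of_nonneg_right hdiv (sub_nonneg.2 hδ)
    _ ≤ 2 ^ q := hcount

end RandomizedCounter

theorem tendsto_log_natCast_atTop :
    Filter.Tendsto (fun n : ℕ => Real.log n) Filter.atTop Filter.atTop :=
  Real.tendsto_log_atTop.comp tendsto_natCast_atTop_atTop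

theorem eventually_half_log_le_of_mul_le_two_pow {a : ℝ} (ha : 0 < a) :
    ∀ᶠ n : ℕ in Filter.atTop, ∀ q : ℕ, a * n ≤ 2 ^ q → 1 / 2 * Real.log n ≤ q := by
  filter_upwards [tendsto_log_natCast_atTop.eventually_ge_atTop (-2 * Real.log a),
    Filter.eventually_gt_atTop 0] with n hlarge hn q hbound
  have hn' : (0 : ℝ) < n := by exact_mod_cast hn
  have hlog : Real.log a + Real.log n ≤ q := calc
    Real.log a + Real.log n = Real.log (a * n) := (Real.log_mul ha.ne' hn'.ne').symm
    _ ≤ Real.log (2 ^ q) := Real.log_le_log (by positivity) hbound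
    _ = q * Real.log 2 := Real.log_pow 2 q
    _ ≤ q := mul_le_of_le_one_right (Nat.cast_nonneg q) (by linarith [Real.log_two_lt_d9])
  linarith

theorem eventually_log_div_log_log_le_log :
    ∀ᶠ n : ℕ in Filter.atTop, Real.log n / Real.log (Real.log n) ≤ Real.log n := by
  filter_upwards [tendsto_log_natCast_atTop.eventually_ge_atTop 0,
    (Real.tendsto_log_atTop.comp tendsto_log_natCast_atTop).eventually_ge_atTop 1]
    with n hlog hloglog
  exact div_le_self hlog hloglog

theorem theorem1_general (ε δ : ℝ) (hε : 0 ≤ ε) (hδ : δ < 1) :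
    ∃ c : ℝ, 0 < c ∧ ∃ N : ℕ, ∀ n : ℕ, N ≤ n →
      ∀ (Ω : Type*) [MeasurableSpace Ω] (μ : Measure Ω) [IsProbabilityMeasure μ]
        (alg : RandomizedCounter n Ω) (q : ℕ),
        alg.MakesAtMost q → alg.Approximates μ ε δ → c * Real.log n ≤ (q : ℝ) := by
  obtain ⟨k, hk⟩ := pow_unbounded_of_one_lt ((1 + ε) ^ 2) one_lt_two
  have hk_pos : 0 < k := Nat.pos_of_ne_zero (by rintro rfl; nlinarith)
  have hrate : 0 < (1 - δ) / k := div_pos (sub_pos.2 hδ) (by exact_mod_cast hk_pos)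
  obtain ⟨N, hN⟩ := Filter.eventually_atTop.1 (eventually_half_log_le_of_mul_le_two_pow hrate)
  exact ⟨1 / 2, one_half_pos, N, fun n hn Ω _ μ _ alg q hq happ =>
    hN n hn q (happ.div_mul_le_two_pow hq hε hδ.le hk)⟩

theorem theorem1 (ε δ : ℝ) (hε : ε ∈ Set.Ioo (0 : ℝ) 1) (hδ : δ ∈ Set.Ioo (0 : ℝ) 1) :
    ∃ c : ℝ, 0 < c ∧ ∃ N : ℕ, ∀ n : ℕ, N ≤ n →
      ∀ (Ω : Type*) [MeasurableSpace Ω] (μ : Measure Ω) [IsProbabilityMeasure μ]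
        (alg : RandomizedCounter n Ω) (q : ℕ),
        alg.MakesAtMost q → alg.Approximates μ ε δ →
          c * (Real.log n / Real.log (Real.log n)) ≤ (q : ℝ) := by
  obtain ⟨c, hc, N₁, hlog⟩ := theorem1_general ε δ hε.1.le hδ.2
  obtain ⟨N₂, hdiv⟩ := Filter.eventually_atTop.1 eventually_log_div_log_log_le_log
  exact ⟨c, hc, max N₁ N₂, fun n hn Ω _ μ _ alg q hq happ =>
    (mul_le_mul_of_nonneg_left (hdiv n (le_of_max_le_right hn)) hc.le).trans
      (hlog n (le_of_max_le_left hn) Ω μ alg q hq happ)⟩
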